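/- Let $k$ be a field of characteristic $0$, let $s\ge 1$, $n$ and $d_1,\dots,d_s\ge 2$ be integers, put $d=d_1+\dots+d_s$, and assume that $d<n-1$. Assume moreover that, if $n$ is even, it is not the case that $s=n/2-1$ and $d_1=\dots=d_s=2$. Then a general Fano complete intersection $X\subset\mathbb P^n$ over $k$ of $s$ hypersurfaces of degrees $d_1,\dots,d_s$ contains no $(n-d)$-plane, not even after extension of the ground field. Precisely: for a tuple $F=(F_1,\dots,F_s)$ of forms over $k$ in $x_0,\dots,x_n$ with $\deg F_i=d_i$, let $X_F\subset\mathbb P^n$ be defined by $F_1=\dots=F_s=0$. There is a non-empty Zariski open subset $U$ of the affine space of all such tuples (with the coefficients of the $F_i$ as coordinates) such that for every $F\in U$ the following hold: * $X_F$ is a Fano complete intersection, that is, $d<n+1$ and $X_F$ is non-singular of codimension $s$ (the Jacobian matrix $(\partial F_i/\partial x_j)$ has rank $s$ at every $\overline{k}$-point of $X_F$); * for every field extension $K/k$ there is no linear subspace of $\mathbb P^n_K$ of dimension $n-d$ on which all $F_i$ vanish. Furthermore, for all integers $e,r\ge 2$ one has $\binom{e+r}{r}\ge e(r+1)$, with equality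 if and only if $e=r=2$. -/

import Mathlib

open MvPolynomial

universe u

namespace FanoCI

/-- The parameter space `⨁ᵢ Symᵈⁱ V*`, `dim V = n + 1`: tuples `(F₁, …, F_s)` of forms over `k` in the
variables `x₀, …, xₙ`, with `Fᵢ` homogeneous of degree `dᵢ` (the zero form is allowed). The tuple `F`
stands for the closed subscheme `X_F : F₁ = ⋯ = F_s = 0` of `ℙⁿ`. -/
abbrev Forms (k : Type u) [Field k] (n : ℕ) {s : ℕ} (d : Fin s → ℕ) : Type u :=
  (i : Fin s) → homogeneousSubmodule (Fin (n + 1)) k (d i)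

/-- The index set of the coordinates on the parameter space: pairs of an index `i` and a monomial
of degree `dᵢ` in `x₀, …, xₙ`. -/
abbrev CoeffIndex (n : ℕ) {s : ℕ} (d : Fin s → ℕ) : Type :=
  (i : Fin s) × {m : Fin (n + 1) →₀ ℕ // m.degree = d i}

/-- The coordinates of a point of the parameter space: all the coefficients of the forms. -/
def coeffs {k : Type u} [Field k] {n s : ℕ} {d : Fin s → ℕ} (F : Forms k n d) :
    CoeffIndex n d → k :=
  fun c => coeff c.2.1 (F c.1).1

/-- Zariski open subsets of the parameter space (an affine space over `k`): complements of the
common zero loci of sets of polynomials over `k` in the coefficients. -/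
def IsZariskiOpen {k : Type u} [Field k] {n s : ℕ} {d : Fin s → ℕ} (U : Set (Forms k n d)) : Prop :=
  ∃ S : Set (MvPolynomial (CoeffIndex n d) k), U = {F | ∃ P ∈ S, eval (coeffs F) P ≠ 0}

/-- `X_F` is a non-singular complete intersection of the `s` hypersurfaces `Fᵢ = 0`: at every
geometric point of `X_F` the Jacobian matrix `(∂Fᵢ/∂xⱼ)` has rank `s`. (By the Jacobian criterion
this says that `X_F` is smooth over `k` of pure codimension `s`.) -/
def IsNonsingularCompleteIntersection {k : Type u} [Field k] {n s : ℕ} {d : Fin s → ℕ}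
    (F : Forms k n d) : Prop :=
  ∀ x : Fin (n + 1) → AlgebraicClosure k, x ≠ 0 → (∀ i, aeval x (F i).1 = 0) →
    LinearIndependent (AlgebraicClosure k)
      (fun (i : Fin s) (j : Fin (n + 1)) => aeval x (pderiv j (F i).1))

/-- `X_F` is a Fano complete intersection: it is non-singular and `d₁ + ⋯ + d_s < n + 1`. -/
def IsFanoCompleteIntersection {k : Type u} [Field k] {n s : ℕ} {d : Fin s → ℕ}
    (F : Forms k n d) : Prop :=
  IsNonsingularCompleteIntersection F ∧ ∑ i, d i < n + 1

/-- Over the (infinite) extension field `K` of `k`, the variety `X_F` contains an `r`-plane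
`ℙ(L) ⊆ ℙⁿ`, where `L` is a linear subspace of `Kⁿ⁺¹` of dimension `r + 1`. -/
def ContainsPlane {k : Type u} [Field k] {n s : ℕ} {d : Fin s → ℕ} (F : Forms k n d)
    (K : Type u) [Field K] [Algebra k K] (r : ℕ) : Prop :=
  ∃ L : Submodule K (Fin (n + 1) → K), Module.finrank K L = r + 1 ∧
    ∀ v ∈ L, ∀ i, aeval v (F i).1 = 0

end FanoCI

/-!
The proof is a parameter count. It avoids dimension theory and elimination theory, because both
incidence varieties involved are, chart by chart, affine spaces with explicit coordinates.

Write `D = ∑ i, d i` and `r = n - D`, so that `r ≥ 2`. A linear subspace `L` of dimension `r + 1` is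
the graph of a matrix with `(n - r) * (r + 1) = D * (r + 1)` entries over some `r + 1` coordinates
(`exists_graph_chart`). That all `F i` vanish on `L` is a system of `∑ i, (d i + r).choose r` linear
equations in the coefficients of the `F i`, which can be solved for the coefficients of the monomials
in the chosen `r + 1` coordinates. Hence the tuples `F` that vanish on some `L` in the chart are the
image of a polynomial map from an affine space whose dimension differs from that of the parameter
space by `D * (r + 1) - ∑ i, (d i + r).choose r`. By the inequality `e * (r + 1) ≤ (e + r).choose r`,
which is strict unless `e = r = 2` (`mul_succ_le_choose_and_eq_iff`), this difference is negative:
equality would force `r = 2` and all `d i = 2`, the excluded case `n = 2 * s + 2`. A polynomial map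
to a larger affine space satisfies a polynomial relation, by transcendence degree
(`exists_aeval_eq_zero_of_card_lt`, `exists_eval_eq_zero_of_parameter_count`). The resulting
polynomial in the coefficients of `F` has coefficients in `k` and serves all field extensions.

The singular `X_F` are treated in the same way (`exists_eval_eq_zero_of_singular_chart`): a singular
point `x` together with a linear relation `w` between the gradients at `x` depends on `n + s - 1`
parameters and imposes `n + s` conditions, linear in the coefficients and again explicitly solvable.

The product of the finitely many polynomials obtained from all charts is nonzero, and its
nonvanishing defines the open subset; it is nonempty because `k` is infinite.
-/

namespace FanoCI

/-! ### Polynomial maps to a space of larger dimension -/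

/-- A polynomial map from an affine space to an affine space of larger dimension satisfies a
nontrivial polynomial relation, since polynomials in the variables `τ` have transcendence degree
`|τ|`. -/
theorem exists_aeval_eq_zero_of_card_lt {k σ τ : Type*} [Field k] [Finite σ] [Finite τ]
    (h : Nat.card τ < Nat.card σ) (g : σ → MvPolynomial τ k) :
    ∃ P : MvPolynomial σ k, P ≠ 0 ∧ aeval g P = 0 := by
  by_contra! hP
  have hind : AlgebraicIndependent k g := by
    rw [algebraicIndependent_iff]
    intro p hp
    by_contra hne
    exact hP p hne hp
  have hle := hind.lift_cardinalMk_le_trdeg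
  rw [MvPolynomial.trdeg_of_isDomain, ← Nat.cast_card (α := σ), ← Nat.cast_card (α := τ)] at hle
  simp only [Cardinal.lift_natCast, Nat.cast_le] at hle
  omega

/-! ### Counting monomials -/

/-- Monomials of degree `e` in the variables `α`, as multisets of size `e`. -/
noncomputable def degreeEquivSym (α : Type*) [DecidableEq α] (e : ℕ) :
    {m : α →₀ ℕ // m.degree = e} ≃ Sym α e :=
  (Equiv.subtypeEquivRight fun m => by rfl).trans (Sym.equivNatSum α e).symm

instance finite_degree_eq (α : Type*) [Finite α] (e : ℕ) :
    Finite {m : α →₀ ℕ // m.degree = e} := by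
  classical
  have := Fintype.ofFinite α
  exact Finite.of_equiv _ (degreeEquivSym α e).symm

theorem card_degree_eq (r e : ℕ) :
    Nat.card {m : Fin (r + 1) →₀ ℕ // m.degree = e} = (e + r).choose r := by
  rw [Nat.card_congr (degreeEquivSym (Fin (r + 1)) e), Nat.card_eq_fintype_card,
    Sym.card_sym_eq_choose, Fintype.card_fin, show r + 1 + e - 1 = r + e by omega, add_comm r e,
    Nat.choose_symm_add]

/-! ### The binomial inequality -/

theorem add_one_le_choose (e r : ℕ) (he : 2 ≤ e) (hr : 2 ≤ r) :
    e + 1 ≤ (e + r).choose (r + 1) := by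
  induction e, he using Nat.le_induction with
  | base =>
    rw [show 2 + r = r + 1 + 1 by omega, Nat.choose_succ_self_right]
    omega
  | succ e he ih =>
    rw [show e + 1 + r = e + r + 1 by omega, Nat.choose_succ_succ']
    have : 0 < (e + r).choose r := Nat.choose_pos (by omega)
    omega

/-- Induction on `r` from the case `r = 2`, where the claim is `(e - 1) * (e - 2) > 0`; by Pascal's
rule each step adds at least `e + 1` to the binomial coefficient and only `e` to the product. In
particular the step turns a weak inequality into a strict one. -/
theorem mul_succ_lt_choose (e r : ℕ) (he : 2 ≤ e) (hr : 2 ≤ r) (h : ¬ (e = 2 ∧ r = 2)) :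
    e * (r + 1) < (e + r).choose r := by
  have base : e ≠ 2 → e * 3 < (e + 2).choose 2 := by
    intro he2
    obtain ⟨t, rfl⟩ : ∃ t, e = t + 3 := ⟨e - 3, by omega⟩
    rw [Nat.choose_two_right, Nat.lt_div_iff_mul_lt' (Nat.even_mul_pred_self _).two_dvd]
    simp only [show t + 3 + 2 - 1 = t + 4 by omega]
    nlinarith
  have base' : e * 3 ≤ (e + 2).choose 2 := by
    by_cases he2 : e = 2
    · subst he2; decide
    · exact (base he2).le
  have step (r : ℕ) (hr : 2 ≤ r) (hle : e * (r + 1) ≤ (e + r).choose r) :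
      e * (r + 1 + 1) < (e + (r + 1)).choose (r + 1) := by
    rw [← add_assoc, Nat.choose_succ_succ]
    have := add_one_le_choose e r he hr
    linarith [mul_add e (r + 1) 1]
  have weak (r : ℕ) (hr : 2 ≤ r) : e * (r + 1) ≤ (e + r).choose r := by
    induction r, hr using Nat.le_induction with
    | base => exact base'
    | succ r hr ih => exact (step r hr ih).le
  rcases Nat.lt_or_ge 2 r with h2 | h2
  · obtain ⟨t, rfl⟩ : ∃ t, r = t + 1 := ⟨r - 1, by omega⟩
    exact step t (by omega) (weak t (by omega))
  · obtain rfl : r = 2 := by omega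
    exact base fun he2 => h ⟨he2, rfl⟩

theorem mul_succ_le_choose_and_eq_iff (e r : ℕ) (he : 2 ≤ e) (hr : 2 ≤ r) :
    e * (r + 1) ≤ (e + r).choose r ∧ ((e + r).choose r = e * (r + 1) ↔ e = 2 ∧ r = 2) := by
  by_cases h : e = 2 ∧ r = 2
  · obtain ⟨rfl, rfl⟩ := h
    decide
  · have := mul_succ_lt_choose e r he hr h
    exact ⟨this.le, iff_of_false this.ne' h⟩

/-! ### Coordinates on the space of forms -/

variable {k : Type u} [Field k] {n s : ℕ} {d : Fin s → ℕ}

noncomputable instance : Fintype (CoeffIndex n d) := Fintype.ofFinite _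

/-- The coordinates on the parameter space, as a linear map. -/
def coeffsHom : Forms k n d →ₗ[k] CoeffIndex n d → k where
  toFun := coeffs
  map_add' F G := by ext c; simp [coeffs]
  map_smul' a F := by ext c; simp [coeffs]

theorem coeffs_injective : Function.Injective (coeffs : Forms k n d → CoeffIndex n d → k) := by
  intro F G h
  funext i
  ext m
  by_cases hm : m.degree = d i
  · exact congrFun h ⟨i, m, hm⟩
  · rw [(F i).2.coeff_eq_zero hm, (G i).2.coeff_eq_zero hm]

/-- The tuple of forms whose only nonzero coefficient is a `1` at the coordinate `c`. -/
noncomputable def monomialForm (c : CoeffIndex n d) : Forms k n d :=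
  Pi.single c.1 ⟨monomial c.2.1 1, isHomogeneous_monomial _ c.2.2⟩

theorem monomialForm_self (c : CoeffIndex n d) :
    (monomialForm (k := k) c c.1).1 = monomial c.2.1 1 := by
  simp [monomialForm]

theorem monomialForm_of_ne (c : CoeffIndex n d) {i : Fin s} (h : i ≠ c.1) :
    (monomialForm (k := k) c i).1 = 0 := by
  simp [monomialForm, h]

theorem coeffs_monomialForm [DecidableEq (CoeffIndex n d)] (c : CoeffIndex n d) :
    coeffs (monomialForm (k := k) c) = Pi.single c 1 := by
  classical
  funext ⟨i, m, hm⟩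
  obtain ⟨i', m', hm'⟩ := c
  by_cases hi : i = i'
  · subst hi
    rw [coeffs, monomialForm_self ⟨i, m', hm'⟩, coeff_monomial, Pi.single_apply]
    congr 1
    simp [eq_comm]
  · rw [coeffs, monomialForm_of_ne _ hi, coeff_zero, Pi.single_eq_of_ne]
    intro h
    exact hi (congrArg Sigma.fst h)

theorem coeffs_sum_smul_monomialForm (f : CoeffIndex n d → k) :
    coeffs (∑ c, f c • monomialForm (k := k) c) = f := by
  classical
  change coeffsHom _ = f
  simp only [map_sum, map_smul]
  change ∑ c, f c • coeffs (monomialForm (k := k) c) = f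
  simp only [coeffs_monomialForm]
  ext c
  simp [Finset.sum_apply, Pi.single_apply]

theorem sum_coeffs_smul_monomialForm (F : Forms k n d) :
    ∑ c, coeffs F c • monomialForm c = F :=
  coeffs_injective (coeffs_sum_smul_monomialForm _)

/-! ### The parameter count -/

/-- Let the conditions `Φ q`, indexed by `ι`, be linear in the forms and polynomial in parameters
indexed by `α`, and suppose that they can be solved for the coefficients at the coordinates `ε q`,
because their matrix in these coordinates is the identity. If there are fewer parameters than
conditions, then all forms which satisfy the conditions for some value of the parameters, in any
field extension, lie on one hypersurface of the parameter space. -/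
theorem exists_eval_eq_zero_of_parameter_count {α ι : Type*} [Finite α] [Finite ι]
    [DecidableEq ι] (hcard : Nat.card α < Nat.card ι) (Φ : ι → Forms k n d →ₗ[k] MvPolynomial α k)
    (ε : ι → CoeffIndex n d)
    (hΦ : ∀ q q', Φ q (monomialForm (ε q')) = if q = q' then 1 else 0) :
    ∃ P : MvPolynomial (CoeffIndex n d) k, P ≠ 0 ∧
      ∀ (K : Type u) [Field K] [Algebra k K] (a : α → K) (F : Forms k n d),
        (∀ q, aeval a (Φ q F) = 0) → eval (coeffs F) P = 0 := by
  classical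
  have := Fintype.ofFinite ι
  have hε : Function.Injective ε := by
    intro q q' h
    by_contra hne
    have h1 := hΦ q q
    rw [h, hΦ q q'] at h1
    simp [hne] at h1
  -- `T` consists of the coordinates which are solved for; the parameters together with the
  -- other coordinates map onto the set of forms in question by means of `g`.
  let T : Set (CoeffIndex n d) := Set.range ε
  let eqT : ι ≃ T := Equiv.ofInjective ε hε
  let τ := α ⊕ (Tᶜ : Set (CoeffIndex n d))
  let g : CoeffIndex n d → MvPolynomial τ k := fun c =>
    if h : c ∈ T then
      - ∑ c' : (Tᶜ : Set (CoeffIndex n d)),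
        X (Sum.inr c') * rename Sum.inl (Φ (eqT.symm ⟨c, h⟩) (monomialForm c'.1))
    else X (Sum.inr ⟨c, h⟩)
  have hτ : Nat.card τ < Nat.card (CoeffIndex n d) := by
    have h1 : Nat.card T + Nat.card (Tᶜ : Set (CoeffIndex n d)) = Nat.card (CoeffIndex n d) := by
      rw [← Nat.card_sum]
      exact Nat.card_congr (Equiv.Set.sumCompl T)
    have h2 : Nat.card T = Nat.card ι := Nat.card_congr eqT.symm
    have h3 : Nat.card τ = Nat.card α + Nat.card (Tᶜ : Set (CoeffIndex n d)) := Nat.card_sum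
    omega
  obtain ⟨P, hP, hg⟩ := exists_aeval_eq_zero_of_card_lt hτ g
  refine ⟨P, hP, fun K _ _ a F hF => ?_⟩
  let b : τ → K := Sum.elim a fun c => algebraMap k K (coeffs F c.1)
  have hb (c : CoeffIndex n d) : aeval b (g c) = algebraMap k K (coeffs F c) := by
    by_cases hc : c ∈ T
    · obtain ⟨q, rfl⟩ := hc
      have hq : eqT.symm ⟨ε q, q, rfl⟩ = q := eqT.symm_apply_apply q
      have h0 : ∑ c : T, aeval a (Φ q (coeffs F c.1 • monomialForm c.1)) +
          ∑ c : (Tᶜ : Set (CoeffIndex n d)),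
            aeval a (Φ q (coeffs F c.1 • monomialForm c.1)) = 0 := by
        have h := hF q
        rw [← sum_coeffs_smul_monomialForm F, map_sum, map_sum,
          ← Fintype.sum_subtype_add_sum_subtype (fun c => c ∈ T)] at h
        convert h
      have h1 : ∑ c : T, aeval a (Φ q (coeffs F c.1 • monomialForm c.1)) =
          algebraMap k K (coeffs F (ε q)) := by
        rw [← eqT.sum_comp, Finset.sum_eq_single q]
        · change aeval a (Φ q (coeffs F (ε q) • monomialForm (ε q))) = _
          rw [map_smul, hΦ, if_pos rfl, map_smul, map_one, Algebra.smul_def, mul_one]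
        · intro q' _ hne
          change aeval a (Φ q (coeffs F (ε q') • monomialForm (ε q'))) = _
          rw [map_smul, hΦ, if_neg hne.symm, smul_zero, map_zero]
        · simp
      rw [h1] at h0
      simp only [g, dif_pos (show ε q ∈ T from ⟨q, rfl⟩), hq]
      rw [map_neg, map_sum, eq_comm, ← sub_eq_zero, sub_neg_eq_add, ← h0]
      congr 1
      refine Finset.sum_congr rfl fun c _ => ?_
      rw [map_mul, aeval_X, aeval_rename, map_smul, map_smul, Algebra.smul_def]
      rfl
    · simp [g, hc, b]
  have h1 : aeval (fun c => algebraMap k K (coeffs F c)) P = 0 := by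
    have h2 : aeval b (aeval g P) = 0 := by rw [hg, map_zero]
    rw [← h2, ← AlgHom.comp_apply, comp_aeval]
    simp only [hb]
  have h3 : aeval (fun c => algebraMap k K (coeffs F c)) P = algebraMap k K (eval (coeffs F) P) :=
    aeval_algebraMap_apply K (coeffs F) P
  rw [h3] at h1
  exact (map_eq_zero _).mp h1

/-! ### Values and gradients of forms -/

section Evaluation
variable {R : Type*} [CommRing R] [Algebra k R]

/-- The value of the `l`-th form at the point `ξ`, as a linear function of the forms. -/
noncomputable def evalForm (ξ : Fin (n + 1) → R) (l : Fin s) : Forms k n d →ₗ[k] R :=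
  (aeval ξ).toLinearMap ∘ₗ (homogeneousSubmodule (Fin (n + 1)) k (d l)).subtype ∘ₗ
    LinearMap.proj l

theorem evalForm_apply (ξ : Fin (n + 1) → R) (l : Fin s) (F : Forms k n d) :
    evalForm ξ l F = aeval ξ (F l).1 := rfl

/-- The `m`-th coordinate of the combination of the gradients at `ξ` with coefficients `w`, as a
linear function of the forms. -/
noncomputable def gradForm (ξ : Fin (n + 1) → R) (w : Fin s → R) (m : Fin (n + 1)) :
    Forms k n d →ₗ[k] R :=
  ∑ l, LinearMap.mulLeft k (w l) ∘ₗ (aeval ξ).toLinearMap ∘ₗ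
    ((pderiv m : Derivation k _ _) : MvPolynomial (Fin (n + 1)) k →ₗ[k] _) ∘ₗ
    (homogeneousSubmodule (Fin (n + 1)) k (d l)).subtype ∘ₗ LinearMap.proj l

theorem gradForm_apply (ξ : Fin (n + 1) → R) (w : Fin s → R) (m : Fin (n + 1))
    (F : Forms k n d) :
    gradForm ξ w m F = ∑ l, w l * aeval ξ (pderiv m (F l).1) := by
  simp [gradForm, LinearMap.sum_apply]

theorem evalForm_monomialForm (ξ : Fin (n + 1) → R) (l : Fin s) (c : CoeffIndex n d) :
    evalForm ξ l (monomialForm (k := k) c) =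
      if l = c.1 then aeval ξ (monomial c.2.1 (1 : k)) else 0 := by
  split_ifs with h
  · subst h
    rw [evalForm_apply, monomialForm_self]
  · rw [evalForm_apply, monomialForm_of_ne _ h, map_zero]

theorem gradForm_monomialForm (ξ : Fin (n + 1) → R) (w : Fin s → R) (m : Fin (n + 1))
    (c : CoeffIndex n d) :
    gradForm ξ w m (monomialForm (k := k) c) =
      w c.1 * aeval ξ (pderiv m (monomial c.2.1 (1 : k))) := by
  rw [gradForm_apply, Finset.sum_eq_single c.1]
  · rw [monomialForm_self]
  · intro l _ h
    rw [monomialForm_of_ne _ h, map_zero, map_zero, mul_zero]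
  · simp

end Evaluation

/-! ### Hypersurfaces in the parameter space -/

theorem isZariskiOpen_setOf_eval_ne_zero (P : MvPolynomial (CoeffIndex n d) k) :
    IsZariskiOpen {F : Forms k n d | eval (coeffs F) P ≠ 0} :=
  ⟨{P}, by simp⟩

theorem exists_eval_coeffs_ne_zero [Infinite k] {P : MvPolynomial (CoeffIndex n d) k}
    (hP : P ≠ 0) : ∃ F : Forms k n d, eval (coeffs F) P ≠ 0 := by
  by_contra! h
  refine hP (MvPolynomial.funext fun f => ?_)
  rw [map_zero, ← coeffs_sum_smul_monomialForm f]
  exact h _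

/-- A finite union of sets each of which lies on a hypersurface lies on a hypersurface. -/
theorem exists_forall_eval_eq_zero {J : Type*} [Finite J] (bad : J → Forms k n d → Prop)
    (h : ∀ a, ∃ P : MvPolynomial (CoeffIndex n d) k, P ≠ 0 ∧
      ∀ F, bad a F → eval (coeffs F) P = 0) :
    ∃ P : MvPolynomial (CoeffIndex n d) k, P ≠ 0 ∧
      ∀ a F, bad a F → eval (coeffs F) P = 0 := by
  have := Fintype.ofFinite J
  choose P hP hbad using h
  refine ⟨∏ a, P a, Finset.prod_ne_zero_iff.mpr fun a _ => hP a, fun a F hF => ?_⟩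
  rw [map_prod]
  exact Finset.prod_eq_zero (Finset.mem_univ a) (hbad a F hF)

/-! ### Singular complete intersections -/

/-- The parameters are a point `x` with `x j = 1` and a vector `w` with `w i = 1`: there are
`n + s - 1` of them. The conditions are the `s` equations `F l (x) = 0` and, for `m ≠ j`, the `n`
equations `∑ l, w l * ∂F l/∂x m (x) = 0`. The latter are solved for the coefficients of
`x j ^ (d i - 1) * x m` in `F i`, the former for the coefficients of `x j ^ d l` in `F l`. -/
theorem exists_eval_eq_zero_of_singular_chart (hd : ∀ i, 1 ≤ d i) (i : Fin s) (j : Fin (n + 1)) :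
    ∃ P : MvPolynomial (CoeffIndex n d) k, P ≠ 0 ∧
      ∀ (K : Type u) [Field K] [Algebra k K] (x : Fin (n + 1) → K) (w : Fin s → K)
        (F : Forms k n d), x j = 1 → w i = 1 → (∀ l, aeval x (F l).1 = 0) →
        (∀ m, ∑ l, w l * aeval x (pderiv m (F l).1) = 0) → eval (coeffs F) P = 0 := by
  classical
  let α := {m // m ≠ j} ⊕ {l // l ≠ i}
  let ι := Fin s ⊕ {m // m ≠ j}
  let ξ : Fin (n + 1) → MvPolynomial α k := fun m =>
    if h : m = j then 1 else X (Sum.inl ⟨m, h⟩)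
  let w : Fin s → MvPolynomial α k := fun l => if h : l = i then 1 else X (Sum.inr ⟨l, h⟩)
  have hξ : ξ j = 1 := by simp [ξ]
  have hw : w i = 1 := by simp [w]
  -- The coefficients of `x j ^ (d i - 1) * x m` in `F i` also occur in `F i (x)`; the multiples of
  -- the gradient equations subtracted from the equation of index `i` cancel them.
  let Φ : ι → Forms k n d →ₗ[k] MvPolynomial α k := Sum.elim
    (fun l => evalForm ξ l -
      if l = i then ∑ m : {m // m ≠ j}, LinearMap.mulLeft k (ξ m.1) ∘ₗ gradForm ξ w m.1 else 0)
    (fun m => gradForm ξ w m.1)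
  let ε : ι → CoeffIndex n d := Sum.elim
    (fun l => ⟨l, Finsupp.single j (d l), by simp⟩)
    (fun m => ⟨i, Finsupp.single j (d i - 1) + Finsupp.single m.1 1, by
      have := hd i
      simp only [map_add, Finsupp.degree_single]
      omega⟩)
  have hcard : Nat.card α < Nat.card ι := by
    have hs := i.2
    simp only [α, ι, Nat.card_eq_fintype_card, Fintype.card_sum, Fintype.card_fin,
      Fintype.card_subtype_compl, Fintype.card_subtype_eq]
    omega
  have hE1 (a : ℕ) : aeval ξ (monomial (Finsupp.single j a) (1 : k)) = 1 := by
    rw [aeval_monomial]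
    simp [hξ]
  have hE2 (a : ℕ) (m : Fin (n + 1)) :
      aeval ξ (monomial (Finsupp.single j a + Finsupp.single m 1) (1 : k)) = ξ m := by
    rw [show monomial (Finsupp.single j a + Finsupp.single m 1) (1 : k) = X j ^ a * X m by
      simp [X, monomial_pow, monomial_mul]]
    simp [hξ]
  have hD1 (a : ℕ) (m : {m // m ≠ j}) :
      aeval ξ (pderiv m.1 (monomial (Finsupp.single j a) (1 : k))) = 0 := by
    simp [pderiv_monomial, Finsupp.single_eq_of_ne m.2]
  have hD2 (a : ℕ) (m m' : {m // m ≠ j}) :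
      aeval ξ (pderiv m.1 (monomial (Finsupp.single j a + Finsupp.single m'.1 1) (1 : k))) =
        if m = m' then 1 else 0 := by
    rw [show monomial (Finsupp.single j a + Finsupp.single m'.1 1) (1 : k) = X j ^ a * X m'.1 by
      simp [X, monomial_pow, monomial_mul]]
    rw [pderiv_mul, pderiv_pow, pderiv_X_of_ne m.2.symm]
    by_cases h : m = m'
    · subst h
      simp [hξ]
    · rw [pderiv_X_of_ne fun h' => h (Subtype.ext h'.symm)]
      simp [h]
  have hgl (m : {m // m ≠ j}) (l : Fin s) :
      gradForm ξ w m.1 (monomialForm (k := k) (ε (Sum.inl l))) = 0 := by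
    rw [gradForm_monomialForm]
    simp only [ε, Sum.elim_inl, hD1, mul_zero]
  have hgr (m m' : {m // m ≠ j}) :
      gradForm ξ w m.1 (monomialForm (k := k) (ε (Sum.inr m'))) = if m = m' then 1 else 0 := by
    rw [gradForm_monomialForm]
    simp only [ε, Sum.elim_inr, hD2, hw, one_mul]
  have hΦ (q q' : Fin s ⊕ {m // m ≠ j}) :
      Φ q (monomialForm (ε q')) = if q = q' then 1 else 0 := by
    rcases q with l | m <;> rcases q' with l' | m'
    · have h1 : evalForm ξ l (monomialForm (k := k) (ε (Sum.inl l'))) = if l = l' then 1 else 0 := by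
        rw [evalForm_monomialForm]
        simp only [ε, Sum.elim_inl, hE1]
      by_cases hl : l = i
      · rw [hl] at h1 ⊢
        simp [Φ, h1, hgl, LinearMap.sum_apply]
      · simp [Φ, h1, hl]
    · have h1 : evalForm ξ l (monomialForm (k := k) (ε (Sum.inr m'))) =
          if l = i then ξ m' else 0 := by
        rw [evalForm_monomialForm]
        simp only [ε, Sum.elim_inr, hE2]
      by_cases hl : l = i
      · rw [hl] at h1 ⊢
        simp [Φ, h1, hgr, LinearMap.sum_apply]
      · simp [Φ, h1, hl]
    · simp [Φ, hgl]
    · simp [Φ, hgr]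
  obtain ⟨P, hP, h⟩ := exists_eval_eq_zero_of_parameter_count hcard Φ ε hΦ
  refine ⟨P, hP, fun K _ _ x v F hx hv hF hgrad => ?_⟩
  let a : α → K := Sum.elim (fun m => x m.1) (fun l => v l.1)
  have hax (m : Fin (n + 1)) : aeval a (ξ m) = x m := by
    by_cases hm : m = j
    · simp [ξ, hm, hx]
    · simp [ξ, hm, a]
  have hav (l : Fin s) : aeval a (w l) = v l := by
    by_cases hl : l = i
    · simp [w, hl, hv]
    · simp [w, hl, a]
  have hev (p : MvPolynomial (Fin (n + 1)) k) : aeval a (aeval ξ p) = aeval x p := by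
    rw [← AlgHom.comp_apply, comp_aeval]
    simp only [hax]
  have hag (m : Fin (n + 1)) : aeval a (gradForm ξ w m F) = 0 := by
    rw [gradForm_apply, map_sum, ← hgrad m]
    simp only [map_mul, hav, hev]
  refine h K a F fun q => ?_
  rcases q with l | m
  · have h1 : aeval a (evalForm ξ l F) = 0 := by rw [evalForm_apply, hev, hF]
    by_cases hl : l = i
    · subst hl
      simp [Φ, h1, LinearMap.sum_apply, hag]
    · simp [Φ, h1, hl]
  · exact hag m.1

theorem aeval_smul_of_isHomogeneous {σ K : Type*} [Field K] [Algebra k K]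
    {p : MvPolynomial σ k} {e : ℕ} (hp : p.IsHomogeneous e) (c : K) (x : σ → K) :
    aeval (c • x) p = c ^ e * aeval x p := by
  rw [aeval_def, aeval_def, eval₂_eq, eval₂_eq, Finset.mul_sum]
  refine Finset.sum_congr rfl fun m hm => ?_
  have hm' : m.degree = e := by
    by_contra h
    exact mem_support_iff.mp hm (hp.coeff_eq_zero h)
  simp only [Pi.smul_apply, smul_eq_mul, mul_pow, Finset.prod_mul_distrib, Finset.prod_pow_eq_pow_sum]
  rw [show ∑ i ∈ m.support, m i = e from hm']
  ring

/-- The singular `X_F` form a subset of a hypersurface: they are covered by the charts where a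
coordinate of the singular point and a coefficient of the relation between the gradients are `1`. -/
theorem exists_eval_eq_zero_of_singular (hd : ∀ i, 1 ≤ d i) :
    ∃ P : MvPolynomial (CoeffIndex n d) k, P ≠ 0 ∧
      ∀ F : Forms k n d, ¬ IsNonsingularCompleteIntersection F → eval (coeffs F) P = 0 := by
  let bad : Fin s × Fin (n + 1) → Forms k n d → Prop := fun p F =>
    ∃ (x : Fin (n + 1) → AlgebraicClosure k) (w : Fin s → AlgebraicClosure k),
      x p.2 = 1 ∧ w p.1 = 1 ∧ (∀ l, aeval x (F l).1 = 0) ∧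
        ∀ m, ∑ l, w l * aeval x (pderiv m (F l).1) = 0
  obtain ⟨P, hP, h⟩ := exists_forall_eval_eq_zero bad fun p => by
    obtain ⟨P, hP, h⟩ := exists_eval_eq_zero_of_singular_chart (k := k) hd p.1 p.2
    exact ⟨P, hP, fun F ⟨x, w, hx, hw, hF, hgrad⟩ => h _ x w F hx hw hF hgrad⟩
  refine ⟨P, hP, fun F hF => ?_⟩
  simp only [IsNonsingularCompleteIntersection, not_forall] at hF
  obtain ⟨x, hx, hxF, hdep⟩ := hF
  obtain ⟨w, hw, i, hi⟩ := Fintype.not_linearIndependent_iff.mp hdep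
  obtain ⟨j, hj⟩ := Function.ne_iff.mp hx
  rw [Pi.zero_apply] at hj
  -- Dividing `x` by `x j` multiplies the `l`-th gradient by `(x j)⁻¹ ^ (d l - 1)`, which the
  -- coefficients `w l` of the linear relation have to absorb.
  let y : Fin (n + 1) → AlgebraicClosure k := (x j)⁻¹ • x
  let c : AlgebraicClosure k := (w i * x j ^ (d i - 1))⁻¹
  refine h (i, j) F ⟨y, fun l => c * (w l * x j ^ (d l - 1)), ?_, ?_, fun l => ?_, fun m => ?_⟩
  · simp [y, hj]
  · exact inv_mul_cancel₀ (mul_ne_zero hi (pow_ne_zero _ hj))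
  · rw [aeval_smul_of_isHomogeneous (F l).2, hxF, mul_zero]
  · have hm := congrFun hw m
    simp only [Finset.sum_apply, Pi.smul_apply, smul_eq_mul, Pi.zero_apply] at hm
    calc ∑ l, c * (w l * x j ^ (d l - 1)) * aeval y (pderiv m (F l).1)
        = ∑ l, c * (w l * aeval x (pderiv m (F l).1)) := by
          refine Finset.sum_congr rfl fun l _ => ?_
          have hl : (F l).1.IsHomogeneous (d l) := (F l).2
          rw [aeval_smul_of_isHomogeneous hl.pderiv, inv_pow]
          have hne : x j ^ (d l - 1) ≠ 0 := pow_ne_zero _ hj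
          field_simp
      _ = 0 := by rw [← Finset.mul_sum, hm, mul_zero]

/-! ### Complete intersections containing a plane -/

/-- The parameters are the entries of the matrix `A` outside the rows `ε`, where it is the identity
matrix: there are `(n - r) * (r + 1)` of them. That `F i` vanishes on the column space of `A` means
that the form `F i (A t)` in `r + 1` variables `t` is zero; its coefficient at a monomial `t ^ μ` is
solved for the coefficient of `F i` at the same monomial in the variables `x (ε l)`. -/
theorem exists_eval_eq_zero_of_plane_chart [Infinite k] {r : ℕ} (ε : Fin (r + 1) → Fin (n + 1))
    (hε : Function.Injective ε)
    (hcount : (n - r) * (r + 1) < ∑ i, (d i + r).choose r) :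
    ∃ P : MvPolynomial (CoeffIndex n d) k, P ≠ 0 ∧
      ∀ (K : Type u) [Field K] [Algebra k K] (A : Fin (n + 1) → Fin (r + 1) → K)
        (F : Forms k n d), (∀ i l, A (ε i) l = if i = l then 1 else 0) →
        (∀ (t : Fin (r + 1) → K) i, aeval (fun j => ∑ l, A j l * t l) (F i).1 = 0) →
        eval (coeffs F) P = 0 := by
  classical
  let α := {j // j ∉ Set.range ε} × Fin (r + 1)
  let ι := (i : Fin s) × {μ : Fin (r + 1) →₀ ℕ // μ.degree = d i}
  let S := MvPolynomial (Fin (r + 1)) (MvPolynomial α k)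
  let ℓ : Fin (n + 1) → S := fun j =>
    if h : j ∈ Set.range ε then X h.choose else ∑ l, C (X (⟨j, h⟩, l)) * X l
  have hℓ (i : Fin (r + 1)) : ℓ (ε i) = X i := by
    have h : ε i ∈ Set.range ε := ⟨i, rfl⟩
    simp only [ℓ, dif_pos h]
    rw [hε h.choose_spec]
  let Φ : ι → Forms k n d →ₗ[k] MvPolynomial α k := fun q =>
    ((lcoeff (MvPolynomial α k) q.2.1).restrictScalars k) ∘ₗ evalForm ℓ q.1
  let η : ι → CoeffIndex n d := fun q =>
    ⟨q.1, q.2.1.mapDomain ε, by rw [Finsupp.degree_mapDomain, q.2.2]⟩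
  have hcard : Nat.card α < Nat.card ι := by
    have hα : Nat.card α = (n - r) * (r + 1) := by
      have h1 : Nat.card {j // j ∉ Set.range ε} = n - r := by
        rw [Nat.card_eq_fintype_card, Fintype.card_subtype_compl, Fintype.card_fin]
        have h2 : Fintype.card {j // j ∈ Set.range ε} = r + 1 := by
          rw [← Nat.card_eq_fintype_card, Nat.card_congr (Equiv.ofInjective ε hε).symm,
            Nat.card_fin]
        omega
      simp only [α, Nat.card_prod, h1, Nat.card_fin]
    have hι : Nat.card ι = ∑ i, (d i + r).choose r := by
      simp only [ι, Nat.card_sigma, card_degree_eq]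
    omega
  have hΦ (q q' : ι) : Φ q (monomialForm (η q')) = if q = q' then 1 else 0 := by
    obtain ⟨i, μ, hμ⟩ := q
    obtain ⟨i', μ', hμ'⟩ := q'
    have h1 : aeval ℓ (monomial (μ'.mapDomain ε) (1 : k)) = monomial μ' 1 := by
      rw [← rename_monomial, aeval_rename, aeval_monomial, map_one, monomial_eq, map_one]
      simp [hℓ]
    change coeff μ (evalForm ℓ i (monomialForm (η ⟨i', μ', hμ'⟩))) = _
    rw [evalForm_monomialForm]
    simp only [η, h1]
    by_cases hi : i = i'
    · subst hi
      rw [if_pos rfl, coeff_monomial]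
      by_cases h : μ = μ'
      · subst h
        simp
      · rw [if_neg (Ne.symm h), if_neg]
        intro hq
        cases hq
        exact h rfl
    · rw [if_neg hi, coeff_zero, if_neg]
      intro hq
      exact hi (congrArg Sigma.fst hq)
  obtain ⟨P, hP, h⟩ := exists_eval_eq_zero_of_parameter_count hcard Φ η hΦ
  refine ⟨P, hP, fun K _ _ A F hA hF => ?_⟩
  have : Infinite K := Infinite.of_injective _ (algebraMap k K).injective
  let a : α → K := fun p => A p.1.1 p.2
  refine h K a F fun q => ?_
  have hzero : mapAlgHom (σ := Fin (r + 1)) (aeval a : MvPolynomial α k →ₐ[k] K)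
      (aeval ℓ (F q.1).1) = 0 := by
    refine MvPolynomial.funext fun t => ?_
    rw [map_zero, ← hF t q.1]
    let Ψ : S →ₐ[k] K := ((aeval t : MvPolynomial (Fin (r + 1)) K →ₐ[K] K).restrictScalars k).comp
      (mapAlgHom (aeval a : MvPolynomial α k →ₐ[k] K))
    have hΨX (i : Fin (r + 1)) : Ψ (X i) = t i := by
      change aeval t (map _ (X i)) = t i
      rw [map_X, aeval_X]
    have hΨC (p : MvPolynomial α k) : Ψ (C p) = aeval a p := by
      change aeval t (map _ (C p)) = _
      rw [map_C, aeval_C]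
      rfl
    have hΨ (j : Fin (n + 1)) : Ψ (ℓ j) = ∑ l, A j l * t l := by
      by_cases hj : j ∈ Set.range ε
      · obtain ⟨i, rfl⟩ := hj
        simp [hΨX, hℓ, hA]
      · rw [show ℓ j = ∑ l, C (X (⟨j, hj⟩, l)) * X l from dif_neg hj, map_sum]
        simp only [map_mul, hΨX, hΨC, aeval_X, a]
    change Ψ (aeval ℓ (F q.1).1) = _
    rw [← AlgHom.comp_apply, comp_aeval]
    simp only [hΨ]
  have h1 := congrArg (coeff q.2.1) hzero
  rw [coeff_zero, mapAlgHom_apply, coeff_map] at h1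
  exact h1

/-- Every linear subspace of dimension `r + 1` is the graph of a linear map over the coordinate
subspace of some `r + 1` coordinates: the column space of a matrix `A` which is the identity in the
rows `ε`. -/
theorem exists_graph_chart {K : Type*} [Field K] {n r : ℕ} (L : Submodule K (Fin (n + 1) → K))
    (hL : Module.finrank K L = r + 1) :
    ∃ ε : Fin (r + 1) → Fin (n + 1), Function.Injective ε ∧
      ∃ A : Fin (n + 1) → Fin (r + 1) → K, (∀ i l, A (ε i) l = if i = l then 1 else 0) ∧
        ∀ t : Fin (r + 1) → K, (fun j => ∑ l, A j l * t l) ∈ L := by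
  -- The coordinates `ε` are those whose restrictions to `L` form a basis of the dual of `L`.
  let v : Fin (n + 1) → Module.Dual K L := fun j => LinearMap.proj j ∘ₗ L.subtype
  have hv (x : L) (hx : ∀ j, v j x = 0) : x = 0 := by
    ext j
    exact hx j
  obtain ⟨κ, b, hb, hspan, hli⟩ := exists_linearIndependent' K v
  have : Finite κ := Finite.of_injective b hb
  have := Fintype.ofFinite κ
  have hker (x : L) (hx : ∀ c, v (b c) x = 0) : x = 0 := by
    refine hv x fun j => ?_
    have hle : Submodule.span K (Set.range (v ∘ b)) ≤ LinearMap.ker (Module.Dual.eval K L x) := by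
      rw [Submodule.span_le]
      rintro _ ⟨c, rfl⟩
      exact hx c
    rw [hspan] at hle
    exact hle (Submodule.subset_span ⟨j, rfl⟩)
  have hκ : Fintype.card κ = r + 1 := by
    apply le_antisymm
    · rw [← hL, ← Subspace.dual_finrank_eq]
      exact hli.fintype_card_le_finrank
    · rw [← hL, ← Module.finrank_fintype_fun_eq_card K]
      refine LinearMap.finrank_le_finrank_of_injective (f := LinearMap.pi fun c => v (b c)) ?_
      rw [injective_iff_map_eq_zero]
      exact fun x hx => hker x fun c => congrFun hx c
  let e : Fin (r + 1) ≃ κ := (Fintype.equivFinOfCardEq hκ).symm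
  let π : L →ₗ[K] Fin (r + 1) → K := LinearMap.pi fun i => v (b (e i))
  have hπ : Function.Injective π := by
    rw [injective_iff_map_eq_zero]
    intro x hx
    refine hker x fun c => ?_
    obtain ⟨i, rfl⟩ := e.surjective c
    exact congrFun hx i
  let E : L ≃ₗ[K] Fin (r + 1) → K := LinearEquiv.ofInjectiveOfFinrankEq π hπ (by simp [hL])
  refine ⟨b ∘ e, hb.comp e.injective, fun j l => (E.symm (Pi.single l 1)).1 j, ?_, ?_⟩
  · intro i l
    have h1 : E (E.symm (Pi.single l 1)) i = (Pi.single l 1 : Fin (r + 1) → K) i := by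
      rw [E.apply_symm_apply]
    rw [Pi.single_apply] at h1
    exact h1
  · intro t
    convert (E.symm t).2
    rename_i j
    conv_rhs => rw [pi_eq_sum_univ' t]
    simp [map_sum, Finset.sum_apply, mul_comm]

theorem exists_eval_eq_zero_of_containsPlane [Infinite k] {r : ℕ}
    (hcount : (n - r) * (r + 1) < ∑ i, (d i + r).choose r) :
    ∃ P : MvPolynomial (CoeffIndex n d) k, P ≠ 0 ∧
      ∀ (F : Forms k n d) (K : Type u) [Field K] [Algebra k K],
        ContainsPlane F K r → eval (coeffs F) P = 0 := by
  let bad : {ε : Fin (r + 1) → Fin (n + 1) // Function.Injective ε} → Forms k n d → Prop :=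
    fun ε F => ∃ (K : Type u) (_ : Field K) (_ : Algebra k K) (A : Fin (n + 1) → Fin (r + 1) → K),
      (∀ i l, A (ε.1 i) l = if i = l then 1 else 0) ∧
        ∀ (t : Fin (r + 1) → K) i, aeval (fun j => ∑ l, A j l * t l) (F i).1 = 0
  obtain ⟨P, hP, h⟩ := exists_forall_eval_eq_zero bad fun ε => by
    obtain ⟨P, hP, h⟩ := exists_eval_eq_zero_of_plane_chart (k := k) ε.1 ε.2 hcount
    exact ⟨P, hP, fun F ⟨K, _, _, A, hA, hF⟩ => h K A F hA hF⟩
  refine ⟨P, hP, fun F K _ _ ⟨L, hL, hLF⟩ => ?_⟩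
  obtain ⟨ε, hε, A, hA, hAL⟩ := exists_graph_chart L hL
  exact h ⟨ε, hε⟩ F ⟨K, _, _, A, hA, fun t i => hLF _ (hAL t) i⟩

/-! ### The general complete intersection -/

/-- The conditions that a plane imposes outnumber the parameters of the planes. -/
theorem sum_mul_succ_lt_sum_choose (d : Fin s → ℕ) (hs : 1 ≤ s) (hd : ∀ i, 2 ≤ d i) {r : ℕ}
    (hr : 2 ≤ r) (hquad : ¬ (r = 2 ∧ ∀ i, d i = 2)) :
    (∑ i, d i) * (r + 1) < ∑ i, (d i + r).choose r := by
  rw [Finset.sum_mul]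
  obtain ⟨i, hi⟩ : ∃ i, ¬ (d i = 2 ∧ r = 2) := by
    by_contra! h
    exact hquad ⟨(h ⟨0, hs⟩).2, fun i => (h i).1⟩
  exact Finset.sum_lt_sum (fun i _ => (mul_succ_le_choose_and_eq_iff _ _ (hd i) hr).1)
    ⟨i, Finset.mem_univ i, mul_succ_lt_choose _ _ (hd i) hr hi⟩

end FanoCI

theorem mainTheorem7 (k : Type u) [Field k] [CharZero k] (n s : ℕ) (hs : 1 ≤ s)
    (d : Fin s → ℕ) (hd : ∀ i, 2 ≤ d i) (hdn : ∑ i, d i + 1 < n)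
    (hquad : Even n → ¬ (s = n / 2 - 1 ∧ ∀ i, d i = 2)) :
    (∃ U : Set (FanoCI.Forms k n d), FanoCI.IsZariskiOpen U ∧ U.Nonempty ∧
      ∀ F ∈ U, FanoCI.IsFanoCompleteIntersection F ∧
        ∀ (K : Type u) [Field K] [Algebra k K],
          ¬ FanoCI.ContainsPlane F K (n - ∑ i, d i)) ∧
    (∀ e r : ℕ, 2 ≤ e → 2 ≤ r →
      e * (r + 1) ≤ (e + r).choose r ∧
        ((e + r).choose r = e * (r + 1) ↔ e = 2 ∧ r = 2)) := by
  refine ⟨?_, FanoCI.mul_succ_le_choose_and_eq_iff⟩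
  have : Infinite k := CharZero.infinite k
  have hquad' : ¬ (n - ∑ i, d i = 2 ∧ ∀ i, d i = 2) := by
    rintro ⟨hr, h2⟩
    have hsum : ∑ i, d i = s * 2 := by simp [h2]
    exact hquad ⟨s + 1, by omega⟩ ⟨by omega, h2⟩
  have hcount : (n - (n - ∑ i, d i)) * (n - ∑ i, d i + 1) <
      ∑ i, (d i + (n - ∑ i, d i)).choose (n - ∑ i, d i) := by
    rw [show n - (n - ∑ i, d i) = ∑ i, d i by omega]
    exact FanoCI.sum_mul_succ_lt_sum_choose d hs hd (by omega) hquad'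
  obtain ⟨P, hP, hplane⟩ := FanoCI.exists_eval_eq_zero_of_containsPlane (k := k) hcount
  obtain ⟨Q, hQ, hsing⟩ := FanoCI.exists_eval_eq_zero_of_singular (k := k) (n := n)
    fun i => one_le_two.trans (hd i)
  refine ⟨{F | eval (FanoCI.coeffs F) (P * Q) ≠ 0}, FanoCI.isZariskiOpen_setOf_eval_ne_zero _,
    FanoCI.exists_eval_coeffs_ne_zero (mul_ne_zero hP hQ), fun F hF => ?_⟩
  rw [Set.mem_ofPred_eq, map_mul] at hF
  refine ⟨⟨?_, by omega⟩, fun K _ _ hK => left_ne_zero_of_mul hF (hplane F K hK)⟩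
  by_contra hsmooth
  exact right_ne_zero_of_mul hF (hsing F hsmooth)
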